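/- A \emph{network} is a finite undirected multigraph $G=(V,\mathcal E)$ without self-loops together with two distinct terminals, an origin $O$ and a destination $D$, such that each vertex and each edge belongs to at least one \emph{route}, i.e. a path without repeated vertices from $O$ to $D$. The network is \emph{series-parallel} (SP) if two routes never pass through an edge in opposite directions. A \emph{traffic network with multiple information types} $(G,\mathcal E_{1:K},s_{1:K},\mathbf c)$ on $G$ consists of a number $K\ge 1$ of types; for each type $i\in\{1,\dots,K\}$ a set $\mathcal E_i\subseteq\mathcal E$ of known edges such that the set $\mathcal R_i$ of routes formed by edges of $\mathcal E_i$ is non-empty, and a traffic demand $s_i\ge 0$; and for each edge $e$ a continuous nondecreasing cost function $c_e:[0,\infty)\to[0,\infty)$. A \emph{feasible flow} assigns to each type $i$ numbers $f^{(i)}_r\ge 0$, $r\in\mathcal R_i$, with $\sum_{r\in\mathcal R_i}f^{(i)}_r=s_i$. Let $f_e$ be the total flow, over all types and all routes through $e$, on the edge $e$; the cost of a route $r$ is $c_r(f)=\sum_{e\in r}c_e(f_e)$. A feasible flow is an \emph{information constrained Wardrop equilibrium} if $c_r(f)\le c_{\tilde r}(f)$ for every $i$ and all $r,\tilde r\in\mathcal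 R_i$ with $f^{(i)}_r>0$. The \emph{equilibrium cost} of type $i$ is the cost, at an equilibrium, of any route $r\in\mathcal R_i$ with $f^{(i)}_r>0$ (it is the same for all equilibria). \emph{Informational Braess' paradox (IBP) with restricted information sets occurs} in $(G,\mathcal E_{1:K},s_{1:K},\mathbf c)$ if $\mathcal E_1\subsetneq\mathcal E$, $\mathcal E_i=\mathcal E$ for $i=2,\dots,K$, and the equilibrium cost of type $1$ after replacing $\mathcal E_1$ by $\tilde{\mathcal E}_1=\mathcal E$ (with everything else unchanged) is strictly larger than the equilibrium cost of type $1$ before. \textbf{Theorem.} For a network $G$, IBP with restricted information sets does not occur in any traffic network on $G$ if and only if $G$ is series-parallel. More specifically: (a) If $G$ is SP, then for every traffic network with multiple information types $(G,\mathcal E_{1:K},s_{1:K},\mathbf c)$, with arbitrary cost functions $\mathbf c$, $K\ge 1$, traffic demands $s_{1:K}$ and information sets, IBP with restricted information sets does not occur. (b) If $G$ is not SP, then there exist cost functions $\mathbf c$, $K\ge 1$, positive traffic demands $s_{1:K}$ and information sets for which IBP with restricted information sets occurs. -/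

import Mathlib

open scoped NNReal Graph

noncomputable section

namespace InfoBraess

/-! ### Two-terminal networks -/

/-- A walk in a multigraph: a sequence of edges in which each edge starts where the previous
one ends. -/
inductive Walk {V E : Type*} (G : Graph V E) : V → V → Type _
  | nil {u : V} : Walk G u u
  | cons {u v w : V} (e : E) (h : G.IsLink e u v) (p : Walk G v w) : Walk G u w

namespace Walk

/-- The vertices visited by a walk, in order. -/
def support {V E : Type*} {G : Graph V E} : {u v : V} → Walk G u v → List V
  | u, _, nil => [u]
  | u, _, cons _ _ p => u :: p.support

/-- The edges used by a walk, in order. -/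
def edges {V E : Type*} {G : Graph V E} : {u v : V} → Walk G u v → List E
  | _, _, nil => []
  | _, _, cons e _ p => e :: p.edges

/-- The directed steps of a walk: `(u, e, v)` is listed when the walk passes through the
edge `e` from `u` to `v`. -/
def steps {V E : Type*} {G : Graph V E} : {u v : V} → Walk G u v → List (V × E × V)
  | _, _, nil => []
  | u, _, cons (v := v) e _ p => (u, e, v) :: p.steps

/-- A path is a walk that visits no vertex twice. -/
def IsPath {V E : Type*} {G : Graph V E} {u v : V} (p : Walk G u v) : Prop :=
  p.support.Nodup

theorem edges_injective {V E : Type*} {G : Graph V E} {u v : V} (p q : Walk G u v)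
    (h : p.edges = q.edges) : p = q := by
  induction p with
  | nil =>
    cases q with
    | nil => rfl
    | cons e he q => simp [edges] at h
  | cons e he p ih =>
    cases q with
    | nil => simp [edges] at h
    | cons e' he' q =>
      simp only [edges, List.cons.injEq] at h
      obtain ⟨rfl, h⟩ := h
      obtain rfl := he.right_unique he'
      rw [ih q h]

theorem edges_mem {V E : Type*} {G : Graph V E} {u v : V} (p : Walk G u v) :
    ∀ e ∈ p.edges, e ∈ E(G) := by
  induction p with
  | nil => simp [edges]
  | cons e he p ih =>
    intro e' he'
    simp only [edges, List.mem_cons] at he'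
    rcases he' with rfl | he'
    · exact he.edge_mem
    · exact ih e' he'

theorem mem_support_of_mem_edges {V E : Type*} {G : Graph V E} {u v : V} (p : Walk G u v) :
    ∀ e ∈ p.edges, ∀ x, G.Inc e x → x ∈ p.support := by
  induction p with
  | nil => simp [edges]
  | cons e he p ih =>
    intro e' he' x hx
    simp only [edges, List.mem_cons] at he'
    simp only [support, List.mem_cons]
    rcases he' with rfl | he'
    · obtain ⟨y, hy⟩ := hx
      rcases he.left_eq_or_eq hy with h | h
      · exact Or.inl h.symm
      · subst h
        obtain rfl := he.right_unique hy.symm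
        right
        cases p <;> simp [support]
    · exact Or.inr (ih e' he' x hx)

theorem IsPath.edges_nodup {V E : Type*} {G : Graph V E} {u v : V} {p : Walk G u v}
    (hp : p.IsPath) : p.edges.Nodup := by
  induction p with
  | nil => simp [edges]
  | cons e he p ih =>
    simp only [IsPath, support, List.nodup_cons] at hp
    simp only [edges, List.nodup_cons]
    exact ⟨fun h => hp.1 (mem_support_of_mem_edges p e h _ ⟨_, he⟩), ih hp.2⟩

end Walk

/-- A network: an undirected multigraph without self-loops and with finitely many edges,
together with two distinct terminals, such that each vertex and each edge belongs to at least
one path from the origin to the destination (so that there are also finitely many vertices). -/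
structure Network (V E : Type*) where
  graph : Graph V E
  loopless : graph.Loopless
  finite_edges : E(graph).Finite
  origin : V
  dest : V
  origin_ne_dest : origin ≠ dest
  vertex_on_route : ∀ v ∈ V(graph),
    ∃ p : Walk graph origin dest, p.IsPath ∧ v ∈ p.support
  edge_on_route : ∀ e ∈ E(graph),
    ∃ p : Walk graph origin dest, p.IsPath ∧ e ∈ p.edges

namespace Network

/-- A route is a path from the origin to the destination. -/
def Route {V E : Type*} (N : Network V E) : Type _ :=
  {p : Walk N.graph N.origin N.dest // p.IsPath}

/-- The edges of a route. -/
def Route.edges {V E : Type*} {N : Network V E} (r : N.Route) : List E := r.1.edges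

/-- The route passes through the edge `e` in the direction from `u` to `v`. -/
def Route.PassesFromTo {V E : Type*} {N : Network V E} (r : N.Route) (e : E) (u v : V) : Prop :=
  (u, e, v) ∈ r.1.steps

instance {V E : Type*} (N : Network V E) : Finite N.Route := by
  have := N.finite_edges.to_subtype
  have := Fintype.ofFinite E(N.graph)
  classical
  have hfin : Finite {l : List E(N.graph) // l.Nodup} := inferInstance
  let g : N.Route → {l : List E(N.graph) // l.Nodup} := fun r =>
    ⟨r.1.edges.attachWith (· ∈ E(N.graph)) r.1.edges_mem, by
      have h := r.2.edges_nodup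
      refine List.Nodup.of_map Subtype.val ?_
      simpa using h⟩
  refine Finite.of_injective g fun r r' h => ?_
  have h' := congrArg (fun l : {l : List E(N.graph) // l.Nodup} => l.1.map Subtype.val) h
  simp only [g] at h'
  exact Subtype.ext (Walk.edges_injective _ _ (by simpa using h'))

instance {V E : Type*} (N : Network V E) : Fintype N.Route := Fintype.ofFinite _

/-- A network is series-parallel if two routes never pass through an edge in opposite
directions. -/
def IsSeriesParallel {V E : Type*} (N : Network V E) : Prop :=
  ∀ (r r' : N.Route) (e : E) (u v : V), ¬ (r.PassesFromTo e u v ∧ r'.PassesFromTo e v u)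

end Network

/-! ### Traffic networks with multiple information types -/

/-- A traffic network with `K` information types on the network `N`: the edges known to each
type, from which at least one route can be formed, the traffic demand of each type, and
continuous nondecreasing nonnegative edge cost functions. -/
structure TrafficNetwork {V E : Type*} (N : Network V E) (K : ℕ) where
  info : Fin K → Set E
  info_subset : ∀ i, info i ⊆ E(N.graph)
  exists_route : ∀ i, ∃ r : N.Route, ∀ e ∈ r.edges, e ∈ info i
  demand : Fin K → ℝ≥0
  cost : E → ℝ≥0 → ℝ≥0
  cost_continuous : ∀ e ∈ E(N.graph), Continuous (cost e)
  cost_monotone : ∀ e ∈ E(N.graph), Monotone (cost e)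

namespace TrafficNetwork

/-- The routes formed by the edges that type `i` knows. -/
def routes {V E : Type*} {N : Network V E} {K : ℕ} (T : TrafficNetwork N K) (i : Fin K) :
    Set N.Route :=
  {r | ∀ e ∈ r.edges, e ∈ T.info i}

/-- `f i r` is the flow of type `i` on route `r`. In a feasible flow, each type sends its whole
demand over the routes that it knows. -/
def IsFeasible {V E : Type*} {N : Network V E} {K : ℕ} (T : TrafficNetwork N K)
    (f : Fin K → N.Route → ℝ≥0) : Prop :=
  ∀ i, (∀ r, r ∉ T.routes i → f i r = 0) ∧ ∑ r, f i r = T.demand i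

open Classical in
/-- The total flow on the edge `e`, over all types and all routes through `e`. -/
def edgeFlow {V E : Type*} {N : Network V E} {K : ℕ}
    (f : Fin K → N.Route → ℝ≥0) (e : E) : ℝ≥0 :=
  ∑ r : N.Route with e ∈ r.edges, ∑ i, f i r

/-- The cost of a route: the sum of the costs of its edges at the current edge flows. (A route
uses no edge twice.) -/
def routeCost {V E : Type*} {N : Network V E} {K : ℕ} (T : TrafficNetwork N K)
    (f : Fin K → N.Route → ℝ≥0) (r : N.Route) : ℝ≥0 :=
  (r.edges.map fun e => T.cost e (edgeFlow f e)).sum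

/-- Information constrained Wardrop equilibrium. -/
def IsICWE {V E : Type*} {N : Network V E} {K : ℕ} (T : TrafficNetwork N K)
    (f : Fin K → N.Route → ℝ≥0) : Prop :=
  T.IsFeasible f ∧
    ∀ i, ∀ r ∈ T.routes i, ∀ r' ∈ T.routes i, 0 < f i r → T.routeCost f r ≤ T.routeCost f r'

/-- `c` is the equilibrium cost of type `i`: the cost, at an equilibrium, of a route that
carries positive flow of type `i`. -/
def IsEquilibriumCost {V E : Type*} {N : Network V E} {K : ℕ} (T : TrafficNetwork N K)
    (i : Fin K) (c : ℝ≥0) : Prop :=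
  ∃ f, T.IsICWE f ∧ ∃ r ∈ T.routes i, 0 < f i r ∧ T.routeCost f r = c

/-- Informational Braess' paradox with restricted information sets occurs in `T`. The type
whose information expands (type `1` in the usual numbering from `1`) has index `0`. It does not
know all edges, and it is informed of all edges; all other types know all edges throughout. -/
def RestrictedIBP {V E : Type*} {N : Network V E} {K : ℕ} [NeZero K]
    (T : TrafficNetwork N K) : Prop :=
  ∃ T' : TrafficNetwork N K,
    T'.demand = T.demand ∧ T'.cost = T.cost ∧
    T.info 0 ⊂ T'.info 0 ∧ T'.info 0 = E(N.graph) ∧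
    (∀ i, i ≠ 0 → T.info i = E(N.graph) ∧ T'.info i = E(N.graph)) ∧
    ∃ c c' : ℝ≥0, T.IsEquilibriumCost 0 c ∧ T'.IsEquilibriumCost 0 c' ∧ c < c'

end TrafficNetwork

end InfoBraess

end

/-! Part (a). Let `f` and `g` be equilibria before and after the expansion.
`exists_route_edgeFlow_le` gives a route `r` on each edge of which `f` is positive and at least `g`.
Hence the new cost of type `0` is at most the cost of `r` under `g`, which by monotonicity is at
most its cost under `f`. By `routeCost_le_of_edgeFlow_pos` this is at most the old cost of type `0`.
The first lemma is a cut argument: series-parallelism orients each edge, so every route crosses a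
cut a net number of one time.

For the second lemma, compare two distance potentials under `f`: `π₁` in the edges known to type
`0`, and `π₂` in all edges. Edges used by type `0` are tight for `π₁`, those used by other types are
tight for `π₂`, and along type `0` routes `π₂` grows no faster than `π₁`. A stretch of `r` between
type `0` edges costs an increase of `π₂`. By `IsSeriesParallel.reaches_of_reaches`, type `0` routes
join the ends of the stretch, so its cost is at most the increase of `π₁`. Summing along `r` gives
the bound.

Part (b). Two routes through an edge in opposite directions produce a route with two crossing ears,
that is, a Wheatstone bridge. Sorting the vertices into four layers transfers the classical Braess
example, with one type and unit demand, to the whole network. Revealing the bridge raises the cost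
from `3 / 2` to `2`. Potentials that are constant on layers certify both equilibria. -/

namespace InfoBraess

/-! ### Walks: cutting, shortcutting, and potentials along them -/

namespace Walk

variable {V E : Type*} {G : Graph V E}

theorem start_mem_support {u v : V} (w : Walk G u v) : u ∈ w.support := by
  cases w <;> simp [support]

theorem end_mem_support {u v : V} (w : Walk G u v) : v ∈ w.support := by
  induction w with
  | nil => simp [support]
  | cons e h p ih => simp [support, ih]

theorem map_steps {u v : V} (w : Walk G u v) : w.steps.map (fun s => s.2.1) = w.edges := by
  induction w with
  | nil => rfl
  | cons e h p ih => simp [steps, edges, ih]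

theorem isLink_of_mem_steps {u v : V} (w : Walk G u v) {x y : V} {e : E}
    (h : (x, e, y) ∈ w.steps) : G.IsLink e x y := by
  induction w with
  | nil => simp [steps] at h
  | cons e' h' p ih =>
    simp only [steps, List.mem_cons, Prod.mk.injEq] at h
    rcases h with ⟨rfl, rfl, rfl⟩ | h
    · exact h'
    · exact ih h

theorem mem_edges_of_mem_steps {u v : V} {w : Walk G u v} {x y : V} {e : E}
    (h : (x, e, y) ∈ w.steps) : e ∈ w.edges := by
  rw [← map_steps]
  exact List.mem_map.2 ⟨_, h, rfl⟩

theorem exists_step_of_mem_edges {u v : V} {w : Walk G u v} {e : E} (h : e ∈ w.edges) :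
    ∃ x y, (x, e, y) ∈ w.steps := by
  rw [← map_steps] at h
  obtain ⟨⟨x, e', y⟩, h', rfl⟩ := List.mem_map.1 h
  exact ⟨x, y, h'⟩

theorem exists_concat {u v x : V} (w : Walk G u v) {e : E} (h : G.IsLink e v x) :
    ∃ w' : Walk G u x, w'.edges = w.edges ++ [e] := by
  induction w with
  | nil => exact ⟨cons e h nil, rfl⟩
  | cons e' h' w ih =>
    obtain ⟨w', hw'⟩ := ih h
    exact ⟨cons e' h' w', by simp [edges, hw']⟩

/-- A walk can be cut at any of its steps. -/
theorem exists_split {u v : V} (w : Walk G u v) {x y : V} {e : E} (h : (x, e, y) ∈ w.steps) :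
    ∃ (w₁ : Walk G u x) (w₂ : Walk G y v), w.support = w₁.support ++ w₂.support ∧
      w.steps = w₁.steps ++ (x, e, y) :: w₂.steps := by
  induction w with
  | nil => simp [steps] at h
  | cons e' h' p ih =>
    simp only [steps, List.mem_cons, Prod.mk.injEq] at h
    rcases h with ⟨rfl, rfl, rfl⟩ | h
    · exact ⟨nil, p, by simp [support], by simp [steps]⟩
    · obtain ⟨w₁, w₂, hs, ht⟩ := ih h
      exact ⟨cons e' h' w₁, w₂, by simp [support, hs], by simp [steps, ht]⟩

theorem exists_suffix {u v : V} (w : Walk G u v) {x : V} (h : x ∈ w.support) :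
    ∃ w' : Walk G x v, w'.support.Sublist w.support ∧ w'.steps.Sublist w.steps := by
  induction w with
  | nil =>
    simp only [support, List.mem_singleton] at h
    subst h
    exact ⟨nil, List.Sublist.refl _, List.Sublist.refl _⟩
  | cons e h' p ih =>
    simp only [support, List.mem_cons] at h
    rcases h with rfl | h
    · exact ⟨cons e h' p, List.Sublist.refl _, List.Sublist.refl _⟩
    · obtain ⟨w', h₁, h₂⟩ := ih h
      exact ⟨w', h₁.cons _, h₂.cons _⟩

/-- Every walk contains a path with the same ends. -/
theorem exists_isPath {u v : V} (w : Walk G u v) :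
    ∃ p : Walk G u v, p.IsPath ∧ p.steps.Sublist w.steps := by
  induction w with
  | nil => exact ⟨nil, by simp [IsPath, support], List.Sublist.refl _⟩
  | @cons u x v e h w ih =>
    obtain ⟨p, hp, hs⟩ := ih
    by_cases hu : u ∈ p.support
    · obtain ⟨p', h₁, h₂⟩ := p.exists_suffix hu
      exact ⟨p', List.Nodup.sublist h₁ hp, (h₂.trans hs).cons _⟩
    · exact ⟨cons e h p, List.nodup_cons.2 ⟨hu, hp⟩, hs.cons_cons _⟩

theorem exists_step_leaving {u v : V} (w : Walk G u v) {S : Set V} (hu : u ∈ S) (hv : v ∉ S) :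
    ∃ x e y, (x, e, y) ∈ w.steps ∧ x ∈ S ∧ y ∉ S := by
  induction w with
  | nil => exact absurd hu hv
  | @cons u x v e h w ih =>
    by_cases hx : x ∈ S
    · obtain ⟨a, e', b, h₁, h₂⟩ := ih hx hv
      exact ⟨a, e', b, List.mem_cons_of_mem _ h₁, h₂⟩
    · exact ⟨u, e, x, List.mem_cons_self, hu, hx⟩

/-- Telescoping: a potential certifies a lower bound on the length of every walk whose steps respect
it. -/
theorem le_add_sum {u v : V} (w : Walk G u v) (π : V → ℝ) (W : E → ℝ)
    (h : ∀ x e y, (x, e, y) ∈ w.steps → π y ≤ π x + W e) :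
    π v ≤ π u + (w.edges.map W).sum := by
  induction w with
  | nil => simp [edges]
  | cons e h' w ih =>
    have h₁ := h _ _ _ List.mem_cons_self
    have h₂ := ih fun x e y hs => h x e y (List.mem_cons_of_mem _ hs)
    simp only [edges, List.map_cons, List.sum_cons]
    linarith

theorem eq_add_sum {u v : V} (w : Walk G u v) (π : V → ℝ) (W : E → ℝ)
    (h : ∀ x e y, (x, e, y) ∈ w.steps → π y = π x + W e) :
    π v = π u + (w.edges.map W).sum := by
  induction w with
  | nil => simp [edges]
  | cons e h' w ih =>
    have h₁ := h _ _ _ List.mem_cons_self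
    have h₂ := ih fun x e y hs => h x e y (List.mem_cons_of_mem _ hs)
    simp only [edges, List.map_cons, List.sum_cons]
    linarith

/-- If a potential grows along a walk by the whole length of the walk, then it grows along
each step by the length of that step. -/
theorem step_tight {u v : V} (w : Walk G u v) (π : V → ℝ) (W : E → ℝ)
    (h : ∀ x e y, (x, e, y) ∈ w.steps → π y ≤ π x + W e)
    (hw : π u + (w.edges.map W).sum ≤ π v) :
    ∀ x e y, (x, e, y) ∈ w.steps → π y = π x + W e := by
  induction w with
  | nil => simp [steps]
  | cons e' h' w ih =>
    have h₁ := h _ _ _ List.mem_cons_self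
    have h₂ : ∀ x e y, (x, e, y) ∈ w.steps → π y ≤ π x + W e :=
      fun x e y hs => h x e y (List.mem_cons_of_mem _ hs)
    have h₃ := w.le_add_sum π W h₂
    simp only [edges, List.map_cons, List.sum_cons] at hw
    intro x e y hs
    simp only [steps, List.mem_cons, Prod.mk.injEq] at hs
    rcases hs with ⟨rfl, rfl, rfl⟩ | hs
    · linarith
    · exact ih h₂ (by linarith) x e y hs

end Walk

/-! ### Reachability by directed steps -/

/-- `v` can be reached from `u` by directed steps `(x, e, y)` that satisfy `Q`. -/
def Reaches {V E : Type*} (Q : V → E → V → Prop) : V → V → Prop :=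
  Relation.ReflTransGen fun x y => ∃ e, Q x e y

namespace Walk

variable {V E : Type*} {G : Graph V E}

theorem reaches {u v : V} (w : Walk G u v) {Q : V → E → V → Prop}
    (h : ∀ x e y, (x, e, y) ∈ w.steps → Q x e y) : Reaches Q u v := by
  induction w with
  | nil => exact Relation.ReflTransGen.refl
  | cons e h' w ih =>
    exact Relation.ReflTransGen.head ⟨e, h _ _ _ List.mem_cons_self⟩
      (ih fun x e y hs => h x e y (List.mem_cons_of_mem _ hs))

theorem reaches_of_mem_steps {u v : V} (w : Walk G u v) {Q : V → E → V → Prop}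
    (h : ∀ x e y, (x, e, y) ∈ w.steps → Q x e y) {x y : V} {e : E} (hs : (x, e, y) ∈ w.steps) :
    Reaches Q u x ∧ Reaches Q y v := by
  obtain ⟨w₁, w₂, -, hw⟩ := w.exists_split hs
  simp only [hw, List.mem_append, List.mem_cons] at h
  exact ⟨w₁.reaches fun _ _ _ h' => h _ _ _ (Or.inl h'),
    w₂.reaches fun _ _ _ h' => h _ _ _ (Or.inr (Or.inr h'))⟩

end Walk

theorem Reaches.mono {V E : Type*} {Q Q' : V → E → V → Prop} {u v : V} (h : Reaches Q u v)
    (hQ : ∀ x e y, Q x e y → Q' x e y) : Reaches Q' u v :=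
  Relation.ReflTransGen.mono (fun x y ⟨e, he⟩ => ⟨e, hQ x e y he⟩) _ _ h

theorem Reaches.swap {V E : Type*} {Q : V → E → V → Prop} {u v : V} (h : Reaches Q u v) :
    Reaches (fun x e y => Q y e x) v u :=
  Relation.reflTransGen_swap.2 h

theorem Reaches.exists_walk {V E : Type*} {G : Graph V E} {Q : V → E → V → Prop}
    (hQ : ∀ x e y, Q x e y → G.IsLink e x y) {u v : V} (h : Reaches Q u v) :
    ∃ w : Walk G u v, ∀ x e y, (x, e, y) ∈ w.steps → Q x e y := by
  induction h using Relation.ReflTransGen.head_induction_on with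
  | refl => exact ⟨.nil, by simp [Walk.steps]⟩
  | head h _ ih =>
    obtain ⟨e, he⟩ := h
    obtain ⟨w, hw⟩ := ih
    refine ⟨.cons e (hQ _ _ _ he) w, fun x e' y hs => ?_⟩
    simp only [Walk.steps, List.mem_cons, Prod.mk.injEq] at hs
    rcases hs with ⟨rfl, rfl, rfl⟩ | hs
    · exact he
    · exact hw _ _ _ hs

/-! ### Extracting routes, and distance potentials -/

namespace Network

variable {V E : Type*} (N : Network V E)

/-- Shortcutting a walk to a path only deletes steps, so a property of all steps survives. -/
theorem exists_route_of_reaches {Q : V → E → V → Prop}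
    (hQ : ∀ x e y, Q x e y → N.graph.IsLink e x y) (h : Reaches Q N.origin N.dest) :
    ∃ r : N.Route, ∀ x e y, r.PassesFromTo e x y → Q x e y := by
  obtain ⟨w, hw⟩ := h.exists_walk hQ
  obtain ⟨p, hp, hs⟩ := w.exists_isPath
  exact ⟨⟨p, hp⟩, fun x e y h => hw x e y (hs.subset h)⟩

variable {N}

theorem Route.isLink {r : N.Route} {x y : V} {e : E} (h : r.PassesFromTo e x y) :
    N.graph.IsLink e x y :=
  r.1.isLink_of_mem_steps h

/-- A capped distance from the origin within a set `A` of edges: if no route in `A` is shorter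
than `c`, then the distance of the destination is `c`. -/
theorem exists_potential (W : E → ℝ≥0) (A : Set E) (c : ℝ≥0)
    (hc : ∀ r : N.Route, (∀ e ∈ r.edges, e ∈ A) → c ≤ (r.edges.map W).sum) :
    ∃ π : V → ℝ, π N.origin = 0 ∧ π N.dest = c ∧
      ∀ x e y, N.graph.IsLink e x y → e ∈ A → π y ≤ π x + W e := by
  -- The cap `c` belongs to every set, so the infimum makes sense even at vertices that no walk in
  -- `A` reaches.
  let D : V → Set ℝ := fun v => {t | t = c ∨ ∃ w : Walk N.graph N.origin v,
    (∀ e ∈ w.edges, e ∈ A) ∧ t = ((w.edges.map W).sum : ℝ≥0)}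
  have hne : ∀ v, (D v).Nonempty := fun v => ⟨c, Or.inl rfl⟩
  have hpos : ∀ v, ∀ t ∈ D v, 0 ≤ t := by
    rintro v t (rfl | ⟨w, -, rfl⟩) <;> positivity
  have hbdd : ∀ v, BddBelow (D v) := fun v => ⟨0, fun t ht => hpos v t ht⟩
  refine ⟨fun v => sInf (D v), ?_, ?_, ?_⟩
  · refine le_antisymm (csInf_le (hbdd _) (Or.inr ⟨.nil, ?_, ?_⟩)) (le_csInf (hne _) (hpos _))
    · simp [Walk.edges]
    · simp [Walk.edges]
  · refine le_antisymm (csInf_le (hbdd _) (Or.inl rfl)) (le_csInf (hne _) ?_)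
    rintro t (rfl | ⟨w, hw, rfl⟩)
    · exact le_rfl
    · obtain ⟨p, hp, hs⟩ := w.exists_isPath
      have hs' : p.edges.Sublist w.edges := by
        rw [← p.map_steps, ← w.map_steps]; exact hs.map _
      refine NNReal.coe_le_coe.2 ((hc ⟨p, hp⟩ fun e he => hw e (hs'.subset he)).trans ?_)
      exact (hs'.map W).sum_le_sum fun _ _ => zero_le
  · intro x e y he heA
    rw [← sub_le_iff_le_add]
    refine le_csInf (hne _) ?_
    rintro t (rfl | ⟨w, hw, rfl⟩)
    · rw [sub_le_iff_le_add]
      exact (csInf_le (hbdd _) (Or.inl rfl)).trans (by simp)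
    · rw [sub_le_iff_le_add]
      obtain ⟨w', hw'⟩ := w.exists_concat he
      refine csInf_le (hbdd _) (Or.inr ⟨w', ?_, ?_⟩)
      · intro e' h
        simp only [hw', List.mem_append, List.mem_singleton] at h
        rcases h with h | rfl
        · exact hw _ h
        · exact heA
      · simp [hw']

end Network

end InfoBraess

namespace InfoBraess

/-! ### Rerouting in series-parallel networks -/

namespace Network

variable {V E : Type*} {N : Network V E}

/-- In a series-parallel network, reversed route steps are of no use for reaching the
destination. -/
theorem IsSeriesParallel.exists_route (hN : N.IsSeriesParallel) {Q : V → E → V → Prop}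
    (hQ : ∀ x e y, Q x e y → N.graph.IsLink e x y)
    (h : Reaches (fun x e y => Q x e y ∨ ∃ r : N.Route, r.PassesFromTo e y x)
      N.origin N.dest) :
    ∃ r : N.Route, ∀ x e y, r.PassesFromTo e x y → Q x e y := by
  obtain ⟨r, hr⟩ := N.exists_route_of_reaches (fun x e y h => h.elim (hQ x e y)
    fun ⟨r, hr⟩ => (Route.isLink hr).symm) h
  refine ⟨r, fun x e y h => (hr x e y h).resolve_right ?_⟩
  rintro ⟨r', hr'⟩
  exact hN r r' e x y ⟨h, hr'⟩

/-- Two vertices on routes from a family that are connected by route steps are also connected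
by steps of routes from the family. -/
theorem IsSeriesParallel.reaches_of_reaches (hN : N.IsSeriesParallel) {Q : V → E → V → Prop}
    (hQ : ∀ x e y, Q x e y → N.graph.IsLink e x y) {u v : V}
    (hu : Reaches Q u N.dest) (hv : Reaches Q N.origin v)
    (huv : Reaches (fun x e y => ∃ r : N.Route, r.PassesFromTo e x y) u v) :
    Reaches Q u v := by
  by_contra hcon
  -- `S` is closed under `Q`-steps and misses `v`, so the `Q`-connection from the origin to `v`
  -- stays outside `S`, while the one from `u` to the destination stays inside.
  let S : Set V := {x | Reaches Q u x}
  have hS : ∀ x e y, Q x e y → x ∈ S → y ∈ S := fun x e y h hx =>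
    Relation.ReflTransGen.tail hx ⟨e, h⟩
  let Q' : V → E → V → Prop := fun x e y => Q x e y ∧ (x ∈ S ↔ y ∈ S)
  have h₁ : ∀ {x}, Reaches Q N.origin x → x ∉ S → N.origin ∉ S ∧
      Reaches Q' N.origin x := by
    intro x hx
    induction hx with
    | refl => exact fun h => ⟨h, Relation.ReflTransGen.refl⟩
    | tail _ h ih =>
      obtain ⟨e, he⟩ := h
      intro hz
      have hy := fun hy => hz (hS _ _ _ he hy)
      exact ⟨(ih hy).1, (ih hy).2.tail ⟨e, he, iff_of_false hy hz⟩⟩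
  have h₂ : ∀ {x}, Reaches Q u x → Reaches Q' u x := by
    intro x hx
    induction hx with
    | refl => exact Relation.ReflTransGen.refl
    | tail h' h ih =>
      obtain ⟨e, he⟩ := h
      exact ih.tail ⟨e, he, iff_of_true h' (hS _ _ _ he h')⟩
  obtain ⟨hO, hOv⟩ := h₁ hv hcon
  have huD := h₂ hu
  -- Go from the origin to `v`, back to `u` against route steps, and on to the destination. The
  -- reversed steps can be dispensed with, so some route never crosses the boundary of `S`, although
  -- its ends lie on different sides.
  obtain ⟨r, hr⟩ := hN.exists_route (Q := Q') (fun x e y h => hQ x e y h.1)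
    (((hOv.mono fun _ _ _ => Or.inl).trans (huv.swap.mono fun _ _ _ => Or.inr)).trans
      (huD.mono fun _ _ _ => Or.inl))
  obtain ⟨x, e, y, hs, hx, hy⟩ := r.1.exists_step_leaving (S := Sᶜ) hO (fun h => h hu)
  exact hx (((hr x e y hs).2).2 (not_not.1 hy))

end Network

/-! ### Part (a): comparison of flows and costs -/

namespace TrafficNetwork

open Network

variable {V E : Type*} {N : Network V E} {K : ℕ}

/-- Double counting, valid because a route uses no edge twice. With `χ` the signed crossing number
of a cut, it expresses the total flow by the edge flows. -/
theorem sum_mul_edgeFlow (f : Fin K → N.Route → ℝ≥0) (χ : E → ℝ) :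
    ∑ r : N.Route, ((∑ i, f i r : ℝ≥0) : ℝ) * (r.edges.map χ).sum =
      ∑ e ∈ N.finite_edges.toFinset, χ e * edgeFlow f e := by
  classical
  have h : ∀ r : N.Route, (r.edges.map χ).sum =
      ∑ e ∈ N.finite_edges.toFinset, if e ∈ r.edges then χ e else 0 := by
    intro r
    rw [Route.edges, ← List.sum_toFinset _ r.2.edges_nodup, ← Finset.sum_filter]
    refine Finset.sum_congr ?_ fun _ _ => rfl
    ext e
    simp only [List.mem_toFinset, Finset.mem_filter, Set.Finite.mem_toFinset]
    exact ⟨fun h => ⟨r.1.edges_mem e h, h⟩, fun h => h.2⟩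
  simp_rw [h, Finset.mul_sum]
  rw [Finset.sum_comm]
  refine Finset.sum_congr rfl fun e _ => ?_
  rw [edgeFlow, NNReal.coe_sum, Finset.mul_sum, Finset.sum_filter]
  refine Finset.sum_congr rfl fun r _ => ?_
  split_ifs <;> ring

theorem edgeFlow_pos_iff {f : Fin K → N.Route → ℝ≥0} {e : E} :
    0 < edgeFlow f e ↔ ∃ i, ∃ r : N.Route, e ∈ r.edges ∧ 0 < f i r := by
  classical
  simp only [edgeFlow, pos_iff_ne_zero, ne_eq, Finset.sum_eq_zero_iff, Finset.mem_filter,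
    Finset.mem_univ, true_and, true_imp_iff, not_forall, exists_prop]
  exact ⟨fun ⟨r, h, i, hi⟩ => ⟨i, r, h, hi⟩, fun ⟨i, r, h, hi⟩ => ⟨r, h, i, hi⟩⟩

/-- In a series-parallel network, of two flows with the same nonzero total, the first one uses
all edges of some route at least as much as the second one. -/
theorem exists_route_edgeFlow_le (hN : N.IsSeriesParallel) (f g : Fin K → N.Route → ℝ≥0)
    (hpos : 0 < ∑ r, ∑ i, f i r) (hfg : ∑ r, ∑ i, f i r = ∑ r, ∑ i, g i r) :
    ∃ r : N.Route, ∀ e ∈ r.edges, 0 < edgeFlow f e ∧ edgeFlow g e ≤ edgeFlow f e := by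
  classical
  let R : V → E → V → Prop := fun x e y => ∃ r : N.Route, r.PassesFromTo e x y
  let Q : V → E → V → Prop := fun x e y =>
    R x e y ∧ 0 < edgeFlow f e ∧ edgeFlow g e ≤ edgeFlow f e
  -- As in a residual graph: also allow steps against an edge on which `g` exceeds `f`. If they lead
  -- to the destination, series-parallelism discards the reversed steps; otherwise the reachable set
  -- is a cut.
  let Q' : V → E → V → Prop := fun x e y => Q x e y ∨ R y e x ∧ edgeFlow f e < edgeFlow g e
  by_cases hD : Reaches Q' N.origin N.dest
  · obtain ⟨r, hr⟩ := hN.exists_route (Q := Q) (fun x e y h => h.1.elim fun r hr =>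
      Route.isLink hr) (hD.mono fun x e y he => he.imp id And.left)
    refine ⟨r, fun e he => ?_⟩
    obtain ⟨x, y, hs⟩ := Walk.exists_step_of_mem_edges he
    exact (hr x e y hs).2
  exfalso
  let S : Set V := {x | Reaches Q' N.origin x}
  have hS : ∀ x e y, Q' x e y → x ∈ S → y ∈ S := fun x e y h hx =>
    Relation.ReflTransGen.tail hx ⟨e, h⟩
  have hO : N.origin ∈ S := Relation.ReflTransGen.refl
  let ι : V → ℝ := fun x => if x ∈ S then 0 else 1
  -- The signed crossing number of an edge is well defined because all routes through the edge agree
  -- on its direction.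
  have hχ : ∀ e, ∃ c : ℝ, ∀ x y, R x e y → ι y = ι x + c := by
    intro e
    by_cases h : ∃ x y, R x e y
    · obtain ⟨x, y, r, hr⟩ := h
      refine ⟨ι y - ι x, ?_⟩
      rintro x' y' ⟨r', hr'⟩
      rcases (Route.isLink hr).eq_and_eq_or_eq_and_eq (Route.isLink hr') with
        ⟨rfl, rfl⟩ | ⟨rfl, rfl⟩
      · ring
      · exact (hN r r' e _ _ ⟨hr, hr'⟩).elim
    · exact ⟨0, fun x y hr => (h ⟨x, y, hr⟩).elim⟩
  choose χ hχ using hχ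
  have hone : ∀ r : N.Route, (r.edges.map χ).sum = 1 := by
    intro r
    have := r.1.eq_add_sum ι χ fun x e y hs => hχ e x y ⟨r, hs⟩
    simp only [ι, if_pos hO, if_neg (show N.dest ∉ S from hD), zero_add] at this
    exact this.symm
  have htotal : ∀ f : Fin K → N.Route → ℝ≥0,
      ∑ e ∈ N.finite_edges.toFinset, χ e * edgeFlow f e = (∑ r, ∑ i, f i r : ℝ≥0) := by
    intro f
    rw [← sum_mul_edgeFlow]
    simp [hone]
  have hR : ∀ e ∈ N.finite_edges.toFinset, ∃ x y, R x e y := by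
    intro e he
    obtain ⟨p, hp, hpe⟩ := N.edge_on_route e (by simpa using he)
    obtain ⟨x, y, hs⟩ := Walk.exists_step_of_mem_edges hpe
    exact ⟨x, y, ⟨p, hp⟩, hs⟩
  -- Maximality of `S`: an edge leaving `S` has `f = 0` or `f < g`, and an edge entering `S`,
  -- counted negatively, has `g ≤ f`. Since the total of `f` is positive, some term is positive and
  -- gives a strict inequality between equal totals.
  have hle : ∀ e ∈ N.finite_edges.toFinset, χ e * edgeFlow f e ≤ χ e * edgeFlow g e ∧
      (0 < χ e * edgeFlow f e → χ e * edgeFlow f e < χ e * edgeFlow g e) := by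
    intro e he
    obtain ⟨x, y, hxy⟩ := hR e he
    have hc : χ e = ι y - ι x := by rw [hχ e x y hxy]; ring
    have hf : (0 : ℝ) ≤ edgeFlow f e := NNReal.coe_nonneg _
    by_cases hx : x ∈ S <;> by_cases hy : y ∈ S <;> simp only [ι, hx, hy, if_true, if_false] at hc
    · simp [hc]
    · have h : ¬ (0 < edgeFlow f e ∧ edgeFlow g e ≤ edgeFlow f e) := fun h => hy (hS x e y (Or.inl ⟨hxy, h⟩) hx)
      simp only [not_and, not_le] at h
      rw [hc]
      simp only [sub_zero, one_mul, NNReal.coe_le_coe, NNReal.coe_lt_coe, NNReal.coe_pos]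
      refine ⟨?_, h⟩
      by_cases h0 : 0 < edgeFlow f e
      · exact (h h0).le
      · rw [not_lt.1 h0 |>.antisymm zero_le]; exact zero_le
    · have h := fun h => hx (hS y e x (Or.inr ⟨hxy, h⟩) hy)
      replace h := NNReal.coe_le_coe.2 (not_lt.1 h)
      rw [hc]
      constructor <;> intros <;> linarith
    · simp [hc]
  have : (0 : ℝ) < (∑ r, ∑ i, f i r : ℝ≥0) := by exact_mod_cast hpos
  rw [← htotal f] at this
  obtain ⟨e, he, hpe⟩ := Finset.exists_lt_of_sum_lt (f := fun _ => (0 : ℝ)) (by simpa using this)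
  have := Finset.sum_lt_sum (fun e he => (hle e he).1) ⟨e, he, (hle e he).2 hpe⟩
  rw [htotal, htotal, hfg] at this
  exact this.false

variable {T : TrafficNetwork N K}

theorem IsFeasible.sum_eq {f : Fin K → N.Route → ℝ≥0} (hf : T.IsFeasible f) :
    ∑ r, ∑ i, f i r = ∑ i, T.demand i := by
  rw [Finset.sum_comm]
  exact Finset.sum_congr rfl fun i _ => (hf i).2

theorem IsFeasible.mem_routes {f : Fin K → N.Route → ℝ≥0} (hf : T.IsFeasible f) {i : Fin K}
    {r : N.Route} (h : 0 < f i r) : r ∈ T.routes i := by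
  by_contra hr
  exact h.ne' ((hf i).1 r hr)

theorem exists_min_routeCost (T : TrafficNetwork N K) (f : Fin K → N.Route → ℝ≥0)
    (r₀ : N.Route) : ∃ r, ∀ r', T.routeCost f r ≤ T.routeCost f r' :=
  have : Nonempty N.Route := ⟨r₀⟩
  Finite.exists_min _

/-- In a series-parallel network, if all types but type `0` know all edges, then a route all of
whose edges are in use costs at most the equilibrium cost of type `0`. -/
theorem routeCost_le_of_edgeFlow_pos [NeZero K] (hN : N.IsSeriesParallel)
    {f : Fin K → N.Route → ℝ≥0} (hf : T.IsICWE f)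
    (hinfo : ∀ i, i ≠ 0 → T.info i = E(N.graph)) {r₀ : N.Route} (hr₀ : 0 < f 0 r₀)
    {r : N.Route} (hr : ∀ e ∈ r.edges, 0 < edgeFlow f e) :
    T.routeCost f r ≤ T.routeCost f r₀ := by
  let W : E → ℝ≥0 := fun e => T.cost e (edgeFlow f e)
  let c := T.routeCost f r₀
  have hr₀' := hf.1.mem_routes hr₀
  obtain ⟨π₁, hO₁, hD₁, h₁⟩ := exists_potential W (T.info 0) c
    fun r hr => hf.2 0 r₀ hr₀' r hr hr₀
  obtain ⟨m, hm⟩ := T.exists_min_routeCost f r₀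
  obtain ⟨π₂, hO₂, hD₂, h₂⟩ := exists_potential W E(N.graph) (T.routeCost f m)
    fun r _ => hm r
  have hcost : ∀ r, ((r.edges.map fun e => (W e : ℝ)).sum) = T.routeCost f r := by
    intro r
    simp [routeCost, W, NNReal.coe_list_sum, Function.comp_def]
  let Q : V → E → V → Prop := fun x e y => ∃ r : N.Route, 0 < f 0 r ∧ r.PassesFromTo e x y
  have hQ : ∀ x e y, Q x e y → N.graph.IsLink e x y := fun x e y ⟨r, _, h⟩ => Route.isLink h
  have hQO : ∀ x e y, Q x e y → Reaches Q N.origin x ∧ Reaches Q y N.dest :=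
    fun x e y ⟨r, hr, h⟩ => r.1.reaches_of_mem_steps (fun _ _ _ h' => ⟨r, hr, h'⟩) h
  have hlink₂ : ∀ x e y, N.graph.IsLink e x y → π₂ y ≤ π₂ x + W e :=
    fun x e y h => h₂ x e y h h.edge_mem
  have htight₁ : ∀ x e y, Q x e y → π₁ y = π₁ x + W e := by
    rintro x e y ⟨r, hr, hs⟩
    have hmem := hf.1.mem_routes hr
    refine r.1.step_tight π₁ (fun e => W e) (fun x e y hs => h₁ x e y (Route.isLink hs)
      (hmem e (Walk.mem_edges_of_mem_steps hs))) ?_ x e y hs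
    rw [hO₁, hD₁, zero_add]
    exact (hcost r).le.trans (NNReal.coe_le_coe.2 (hf.2 0 r hmem r₀ hr₀' hr))
  have htight₂ : ∀ i, i ≠ 0 → ∀ r : N.Route, 0 < f i r → ∀ x e y, r.PassesFromTo e x y →
      π₂ y = π₂ x + W e := by
    intro i hi r hr
    have hmem : ∀ r, r ∈ T.routes i := fun r e he => hinfo i hi ▸ r.1.edges_mem e he
    refine r.1.step_tight π₂ (fun e => W e) (fun x e y hs => hlink₂ x e y (Route.isLink hs)) ?_
    rw [hO₂, hD₂, zero_add]
    exact (hcost r).le.trans (NNReal.coe_le_coe.2 (hf.2 i r (hmem _) m (hmem _) hr))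
  -- Type `0` steps are tight for `π₁`, whereas `π₂` grows by at most the edge cost on every edge.
  have hdiff : ∀ u v, Reaches Q u v → π₂ v - π₂ u ≤ π₁ v - π₁ u := by
    intro u v h
    induction h with
    | refl => simp
    | tail _ h ih =>
      obtain ⟨e, he⟩ := h
      have := htight₁ _ _ _ he
      have := hlink₂ _ _ _ (hQ _ _ _ he)
      linarith
  -- Induction on the rest `w` of the route. The marker `u` is the origin or the end of the last
  -- type `0` edge passed; the edges since then were charged to `π₂`, whence the term `π₂ x - π₂ u`.
  have main : ∀ {x y : V} (w : Walk N.graph x y), y = N.dest →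
      (∀ a e b, (a, e, b) ∈ w.steps →
        (∃ r : N.Route, r.PassesFromTo e a b) ∧ 0 < edgeFlow f e) →
      ∀ u, Reaches Q N.origin u → Reaches Q u N.dest →
        Reaches (fun x e y => ∃ r : N.Route, r.PassesFromTo e x y) u x →
        (w.edges.map fun e => (W e : ℝ)).sum + (π₂ x - π₂ u) ≤ π₁ y - π₁ u := by
    intro x y w
    induction w with
    | nil =>
      rintro rfl - u - hu -
      simpa [Walk.edges] using hdiff u _ hu
    | @cons x z y e h w ih =>
      intro hy hw u hOu huD hux
      obtain ⟨⟨r, hr⟩, he⟩ := hw x e z List.mem_cons_self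
      have hw' := fun a e b h => hw a e b (List.mem_cons_of_mem _ h)
      simp only [Walk.edges, List.map_cons, List.sum_cons]
      obtain ⟨i, r', her', hir'⟩ := edgeFlow_pos_iff.1 he
      obtain ⟨a, b, hab⟩ := Walk.exists_step_of_mem_edges her'
      have hxz : r'.PassesFromTo e x z := by
        rcases h.eq_and_eq_or_eq_and_eq (r'.1.isLink_of_mem_steps hab) with
          ⟨rfl, rfl⟩ | ⟨rfl, rfl⟩
        · exact hab
        · exact (hN r r' e _ _ ⟨hr, hab⟩).elim
      by_cases hi : i = 0
      · subst hi
        have hq : Q x e z := ⟨r', hir', hxz⟩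
        -- A type `0` edge closes the current stretch: its charge in `π₂` is converted to `π₁`, and
        -- the marker moves to `z`.
        have hux' := hN.reaches_of_reaches hQ huD (hQO _ _ _ hq).1 hux
        have e₁ := hdiff _ _ hux'
        have e₂ := htight₁ _ _ _ hq
        have e₃ := ih hy hw' z ((hQO _ _ _ hq).1.tail ⟨e, hq⟩) (hQO _ _ _ hq).2
          Relation.ReflTransGen.refl
        linarith
      · have e₁ := htight₂ i hi r' hir' x e z hxz
        have e₂ := ih hy hw' u hOu huD (hux.tail ⟨e, r, hr⟩)
        linarith
  have hOD : Reaches Q N.origin N.dest := r₀.1.reaches fun _ _ _ h => ⟨r₀, hr₀, h⟩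
  have := main r.1 rfl (fun a e b h => ⟨⟨r, h⟩, hr e (Walk.mem_edges_of_mem_steps h)⟩)
    N.origin Relation.ReflTransGen.refl hOD Relation.ReflTransGen.refl
  have h' := hcost r
  simp only [Route.edges] at h'
  rw [h', hO₁, hD₁, sub_self, add_zero, sub_zero] at this
  exact_mod_cast this

theorem not_restrictedIBP [NeZero K] (hN : N.IsSeriesParallel) (T : TrafficNetwork N K) :
    ¬ T.RestrictedIBP := by
  rintro ⟨T', hdem, hcost, -, hinfo', hinfo, c, c', ⟨f, hf, r₀, -, hr₀, rfl⟩,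
    ⟨g, hg, r₁, hr₁, hgr₁, rfl⟩, hlt⟩
  have hpos : 0 < ∑ r, ∑ i, f i r := by
    refine hr₀.trans_le ((Finset.single_le_sum (f := fun i => f i r₀) (fun _ _ => zero_le)
      (Finset.mem_univ 0)).trans ?_)
    exact Finset.single_le_sum (f := fun r => ∑ i, f i r) (fun _ _ => zero_le)
      (Finset.mem_univ r₀)
  obtain ⟨r, hr⟩ := exists_route_edgeFlow_le hN f g hpos
    (by rw [hf.1.sum_eq, hg.1.sum_eq, hdem])
  refine hlt.not_ge ?_
  calc T'.routeCost g r₁ ≤ T'.routeCost g r :=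
        hg.2 0 r₁ hr₁ r (fun e he => hinfo' ▸ r.1.edges_mem e he) hgr₁
    _ ≤ T.routeCost f r := by
        rw [routeCost, routeCost, hcost]
        exact List.sum_le_sum fun e he => T.cost_monotone e (r.1.edges_mem e he) (hr e he).2
    _ ≤ T.routeCost f r₀ := routeCost_le_of_edgeFlow_pos hN hf
        (fun i hi => (hinfo i hi).1) hr₀ fun e he => (hr e he).1

end TrafficNetwork

end InfoBraess

namespace InfoBraess

/-! ### Part (b): Braess' example on a layered network -/

namespace TrafficNetwork

open Network

variable {V E : Type*} {N : Network V E}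

open Classical in
/-- The flow of a single type that is split evenly between two routes. -/
noncomputable def splitFlow (r₁ r₂ : N.Route) : Fin 1 → N.Route → ℝ≥0 := fun _ r =>
  (if r = r₁ then 1 / 2 else 0) + if r = r₂ then 1 / 2 else 0

theorem sum_splitFlow (r₁ r₂ : N.Route) (i : Fin 1) : ∑ r, splitFlow r₁ r₂ i r = 1 := by
  classical
  simp only [splitFlow, Finset.sum_add_distrib, Finset.sum_ite_eq', Finset.mem_univ, if_true]
  exact add_halves 1

open Classical in
theorem edgeFlow_splitFlow (r₁ r₂ : N.Route) (e : E) :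
    edgeFlow (splitFlow r₁ r₂) e =
      (if e ∈ r₁.edges then 1 / 2 else 0) + if e ∈ r₂.edges then 1 / 2 else 0 := by
  simp [edgeFlow, splitFlow, Finset.sum_add_distrib, Finset.sum_ite_eq']

theorem eq_or_eq_of_splitFlow_pos {r₁ r₂ r : N.Route} {i : Fin 1} (h : 0 < splitFlow r₁ r₂ i r) :
    r = r₁ ∨ r = r₂ := by
  by_contra! hr
  simp [splitFlow, hr] at h

/-- A flow that is split between two routes is an equilibrium if a potential certifies that these
routes are shortest ones. -/
theorem isICWE_splitFlow {T : TrafficNetwork N 1} {r₁ r₂ : N.Route} (hT : T.demand = 1)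
    (h₁ : r₁ ∈ T.routes 0) (h₂ : r₂ ∈ T.routes 0) (π : V → ℝ)
    (hle : ∀ x e y, N.graph.IsLink e x y → e ∈ T.info 0 →
      π y ≤ π x + T.cost e (edgeFlow (splitFlow r₁ r₂) e))
    (heq : ∀ r, r = r₁ ∨ r = r₂ → ∀ x e y, r.PassesFromTo e x y →
      π y = π x + T.cost e (edgeFlow (splitFlow r₁ r₂) e)) :
    T.IsICWE (splitFlow r₁ r₂) ∧
      (T.routeCost (splitFlow r₁ r₂) r₁ : ℝ) = π N.dest - π N.origin := by
  have hmem : ∀ r, r = r₁ ∨ r = r₂ → r ∈ T.routes 0 := by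
    rintro r (rfl | rfl) <;> assumption
  have hcost : ∀ r : N.Route, (T.routeCost (splitFlow r₁ r₂) r : ℝ) =
      (r.edges.map fun e => (T.cost e (edgeFlow (splitFlow r₁ r₂) e) : ℝ)).sum := by
    intro r
    simp [routeCost, NNReal.coe_list_sum, Function.comp_def]
  have hr : ∀ r, r = r₁ ∨ r = r₂ →
      (T.routeCost (splitFlow r₁ r₂) r : ℝ) = π N.dest - π N.origin := by
    intro r h
    rw [hcost, eq_sub_iff_add_eq']
    exact (Walk.eq_add_sum r.1 π _ (heq r h)).symm
  refine ⟨⟨fun i => ⟨fun r hri => ?_, ?_⟩, fun i r _ r' hr' hpos => ?_⟩, hr _ (Or.inl rfl)⟩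
  · by_contra h
    obtain rfl := Subsingleton.elim i 0
    exact hri (hmem r (eq_or_eq_of_splitFlow_pos (pos_iff_ne_zero.2 h)))
  · rw [sum_splitFlow, hT, Pi.one_apply]
  · obtain rfl := Subsingleton.elim i 0
    rw [← NNReal.coe_le_coe, hr r (eq_or_eq_of_splitFlow_pos hpos), hcost,
      sub_le_iff_le_add']
    exact Walk.le_add_sum r'.1 π _ fun x e y hs =>
      hle x e y (Route.isLink hs) (hr' e (Walk.mem_edges_of_mem_steps hs))

/-- Braess' paradox from a layering of the vertices: layer `0` contains the origin, layer `3`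
contains the destination, and the bridge from layer `1` to layer `2` is concealed at first. -/
theorem exists_restrictedIBP_of_layers (lay : V → Fin 4) {α β γ : E}
    (hO : lay N.origin = 0) (hD : lay N.dest = 3)
    (hα : ∃ x y, N.graph.IsLink α x y ∧ lay x = 0 ∧ lay y = 1)
    (hβ : ∃ x y, N.graph.IsLink β x y ∧ lay x = 2 ∧ lay y = 3)
    (hγ : ∃ x y, N.graph.IsLink γ x y ∧ lay x = 1 ∧ lay y = 2)
    (h₀ : Reaches (fun x e y => N.graph.IsLink e x y ∧ (lay x = lay y ∨
      (e = α ∧ lay x = 0 ∧ lay y = 1) ∨ (lay x = 1 ∧ lay y = 2) ∨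
      (e = β ∧ lay x = 2 ∧ lay y = 3))) N.origin N.dest)
    (h₁ : Reaches (fun x e y => N.graph.IsLink e x y ∧ (lay x = lay y ∨
      (e = α ∧ lay x = 0 ∧ lay y = 1) ∨ (lay x = 1 ∧ lay y = 3))) N.origin N.dest)
    (h₂ : Reaches (fun x e y => N.graph.IsLink e x y ∧ (lay x = lay y ∨
      (lay x = 0 ∧ lay y = 2) ∨ (e = β ∧ lay x = 2 ∧ lay y = 3))) N.origin N.dest) :
    ∃ T : TrafficNetwork N 1, (∀ i, 0 < T.demand i) ∧ T.RestrictedIBP := by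
  classical
  obtain ⟨r₀, hr₀⟩ := N.exists_route_of_reaches (fun x e y h => h.1) h₀
  obtain ⟨r₁, hr₁⟩ := N.exists_route_of_reaches (fun x e y h => h.1) h₁
  obtain ⟨r₂, hr₂⟩ := N.exists_route_of_reaches (fun x e y h => h.1) h₂
  replace hr₀ := fun x e y h => (hr₀ x e y h).2
  replace hr₁ := fun x e y h => (hr₁ x e y h).2
  replace hr₂ := fun x e y h => (hr₂ x e y h).2
  -- `l` certifies the equilibrium after the bridge is revealed, and `π` the one before. Their
  -- values on layer `3` are the equilibrium costs `2` and `3 / 2`.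
  let l : V → ℝ := fun x => (![0, 1, 1, 2] : Fin 4 → ℝ) (lay x)
  let π : V → ℝ := fun x => (![0, 1 / 2, 1, 3 / 2] : Fin 4 → ℝ) (lay x)
  have hends : ∀ {e : E} {a b : Fin 4}, (∃ x y, N.graph.IsLink e x y ∧ lay x = a ∧ lay y = b) →
      ∀ x y, N.graph.IsLink e x y → (lay x = a ∧ lay y = b) ∨ (lay x = b ∧ lay y = a) := by
    rintro e a b ⟨x, y, h, hx, hy⟩ x' y' h'
    rcases h.eq_and_eq_or_eq_and_eq h' with ⟨rfl, rfl⟩ | ⟨rfl, rfl⟩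
    · exact Or.inl ⟨hx, hy⟩
    · exact Or.inr ⟨hy, hx⟩
  have hα' := hends hα
  have hβ' := hends hβ
  have hw : ∀ e, ∃ c : ℝ≥0, ∀ x y, N.graph.IsLink e x y → (c : ℝ) = |l x - l y| := by
    intro e
    by_cases h : ∃ x y, N.graph.IsLink e x y
    · obtain ⟨x, y, h⟩ := h
      refine ⟨⟨|l x - l y|, abs_nonneg _⟩, fun x' y' h' => ?_⟩
      rcases h.eq_and_eq_or_eq_and_eq h' with ⟨rfl, rfl⟩ | ⟨rfl, rfl⟩
      · rfl
      · exact abs_sub_comm _ _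
    · exact ⟨0, fun x y h' => (h ⟨x, y, h'⟩).elim⟩
  choose w hw using hw
  -- Only `α` and `β` are congestible. The constant on any other edge is the change of `l` across
  -- it, so edges within a layer and between layers `1` and `2` are free.
  let cost : E → ℝ≥0 → ℝ≥0 := fun e t => if e = α ∨ e = β then t else w e
  have hcont : ∀ e ∈ E(N.graph), Continuous (cost e) := by
    intro e _
    by_cases h : e = α ∨ e = β <;> simp only [cost, h, if_true, if_false] <;> fun_prop
  have hmono : ∀ e ∈ E(N.graph), Monotone (cost e) := by
    intro e _ s t hst
    by_cases h : e = α ∨ e = β <;> simp only [cost, h, if_true, if_false, le_refl, hst]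
  -- All edges between layers `1` and `2` are concealed, not only `γ`; `γ` ensures that the
  -- concealed set is nonempty.
  let A : Set E := {e | e ∈ E(N.graph) ∧ ¬ ∃ x y, N.graph.IsLink e x y ∧ lay x = 1 ∧ lay y = 2}
  have hA₁ : ∀ e ∈ r₁.edges, e ∈ A := by
    intro e he
    refine ⟨r₁.1.edges_mem e he, fun h => ?_⟩
    obtain ⟨x, y, hs⟩ := Walk.exists_step_of_mem_edges he
    have := hr₁ x e y hs
    rcases hends h x y (r₁.1.isLink_of_mem_steps hs) with ⟨hx, hy⟩ | ⟨hx, hy⟩ <;>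
      simp [hx, hy] at this
  have hA₂ : ∀ e ∈ r₂.edges, e ∈ A := by
    intro e he
    refine ⟨r₂.1.edges_mem e he, fun h => ?_⟩
    obtain ⟨x, y, hs⟩ := Walk.exists_step_of_mem_edges he
    have := hr₂ x e y hs
    rcases hends h x y (r₂.1.isLink_of_mem_steps hs) with ⟨hx, hy⟩ | ⟨hx, hy⟩ <;>
      simp [hx, hy] at this
  let T : TrafficNetwork N 1 :=
    { info := fun _ => A
      info_subset := fun _ e he => he.1
      exists_route := fun _ => ⟨r₁, hA₁⟩
      demand := 1
      cost := cost
      cost_continuous := hcont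
      cost_monotone := hmono }
  let T' : TrafficNetwork N 1 :=
    { info := fun _ => E(N.graph)
      info_subset := fun _ e he => he
      exists_route := fun _ => ⟨r₁, r₁.1.edges_mem⟩
      demand := 1
      cost := cost
      cost_continuous := hcont
      cost_monotone := hmono }
  have leave₀ : ∀ r : N.Route, ∃ x e y, r.PassesFromTo e x y ∧ lay x = 0 ∧ lay y ≠ 0 := fun r =>
    r.1.exists_step_leaving (S := {x | lay x = 0}) hO (by simp [hD])
  have leave₃ : ∀ r : N.Route, ∃ x e y, r.PassesFromTo e x y ∧ lay x ≠ 3 ∧ lay y = 3 := by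
    intro r
    obtain ⟨x, e, y, h, hx, hy⟩ := r.1.exists_step_leaving (S := {x | lay x ≠ 3})
      (by simp [hO]) (by simp [hD])
    exact ⟨x, e, y, h, hx, not_not.1 hy⟩
  have hα₀ : α ∈ r₀.edges := by
    obtain ⟨x, e, y, h, hx, hy⟩ := leave₀ r₀
    have := hr₀ x e y h
    simp only [hx, hy.symm, false_or, true_and] at this
    simp at this
    exact this.1 ▸ Walk.mem_edges_of_mem_steps h
  have hβ₀ : β ∈ r₀.edges := by
    obtain ⟨x, e, y, h, hx, hy⟩ := leave₃ r₀
    have := hr₀ x e y h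
    simp [hx, hy] at this
    exact this.1 ▸ Walk.mem_edges_of_mem_steps h
  have hα₁ : α ∈ r₁.edges := by
    obtain ⟨x, e, y, h, hx, hy⟩ := leave₀ r₁
    have := hr₁ x e y h
    simp only [hx, hy.symm, false_or, true_and] at this
    simp at this
    exact this.1 ▸ Walk.mem_edges_of_mem_steps h
  have hβ₂ : β ∈ r₂.edges := by
    obtain ⟨x, e, y, h, hx, hy⟩ := leave₃ r₂
    have := hr₂ x e y h
    simp only [hx, hy, false_or] at this
    simp at this
    exact this.1 ▸ Walk.mem_edges_of_mem_steps h
  have hβ₁ : β ∉ r₁.edges := by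
    intro he
    obtain ⟨x, y, hs⟩ := Walk.exists_step_of_mem_edges he
    have := hr₁ x β y hs
    rcases hβ' x y (r₁.1.isLink_of_mem_steps hs) with ⟨hx, hy⟩ | ⟨hx, hy⟩ <;>
      simp [hx, hy] at this
  have hα₂ : α ∉ r₂.edges := by
    intro he
    obtain ⟨x, y, hs⟩ := Walk.exists_step_of_mem_edges he
    have := hr₂ x α y hs
    rcases hα' x y (r₂.1.isLink_of_mem_steps hs) with ⟨hx, hy⟩ | ⟨hx, hy⟩ <;>
      simp [hx, hy] at this
  have hf : ∀ e, e = α ∨ e = β → edgeFlow (splitFlow r₁ r₂) e = 1 / 2 := by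
    rintro e (rfl | rfl) <;> rw [edgeFlow_splitFlow] <;> simp [*]
  have hg : ∀ e, e = α ∨ e = β → edgeFlow (splitFlow r₀ r₀) e = 1 := by
    rintro e (rfl | rfl) <;> rw [edgeFlow_splitFlow] <;> simp only [*, if_true] <;>
      exact add_halves 1
  have hWf : ∀ e x y, N.graph.IsLink e x y →
      ((e = α ∨ e = β) ∧ (cost e (edgeFlow (splitFlow r₁ r₂) e) : ℝ) = 1 / 2) ∨
      ((¬ (e = α ∨ e = β)) ∧ (cost e (edgeFlow (splitFlow r₁ r₂) e) : ℝ) = |l x - l y|) := by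
    intro e x y h
    by_cases he : e = α ∨ e = β
    · exact Or.inl ⟨he, by simp [cost, he, hf]⟩
    · exact Or.inr ⟨he, by simp only [cost, he, if_false, hw e x y h]⟩
  have hWg : ∀ e x y, N.graph.IsLink e x y →
      ((e = α ∨ e = β) ∧ (cost e (edgeFlow (splitFlow r₀ r₀) e) : ℝ) = 1) ∨
      ((¬ (e = α ∨ e = β)) ∧ (cost e (edgeFlow (splitFlow r₀ r₀) e) : ℝ) = |l x - l y|) := by
    intro e x y h
    by_cases he : e = α ∨ e = β
    · exact Or.inl ⟨he, by simp [cost, he, hg]⟩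
    · exact Or.inr ⟨he, by simp only [cost, he, if_false, hw e x y h]⟩
  have hlayαβ : ∀ e x y, N.graph.IsLink e x y → e = α ∨ e = β →
      (lay x = 0 ∧ lay y = 1) ∨ (lay x = 1 ∧ lay y = 0) ∨
      (lay x = 2 ∧ lay y = 3) ∨ (lay x = 3 ∧ lay y = 2) := by
    rintro e x y h (rfl | rfl)
    · exact (hα' x y h).imp_right Or.inl
    · exact Or.inr (Or.inr (hβ' x y h))
  obtain ⟨hfeq, hfcost⟩ := isICWE_splitFlow (T := T) (r₁ := r₁) (r₂ := r₂) rfl hA₁ hA₂ π (by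
    intro x e y h hA
    have hxy : ¬ (lay x = 1 ∧ lay y = 2) := fun h' => hA.2 ⟨x, y, h, h'⟩
    change π y ≤ π x + cost e _
    rcases hWf e x y h with ⟨he, hc⟩ | ⟨he, hc⟩ <;> rw [hc]
    · rcases hlayαβ e x y h he with h | h | h | h <;> simp [π, h] <;> norm_num
    -- Of the sixteen pairs of layers, only the step from `1` to `2` violates the inequality, and
    -- `hxy` excludes it.
    · revert hxy
      simp only [π, l]
      generalize lay x = a
      generalize lay y = b
      fin_cases a <;> fin_cases b <;> norm_num <;> rfl) (by
    have key : ∀ x e y, N.graph.IsLink e x y → (lay x = lay y ∨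
        (e = α ∧ lay x = 0 ∧ lay y = 1) ∨ (lay x = 1 ∧ lay y = 3) ∨
        (lay x = 0 ∧ lay y = 2) ∨ (e = β ∧ lay x = 2 ∧ lay y = 3)) →
        π y = π x + cost e (edgeFlow (splitFlow r₁ r₂) e) := by
      intro x e y h hxy
      rcases hWf e x y h with ⟨he, hc⟩ | ⟨he, hc⟩ <;> rw [hc]
      · rcases hlayαβ e x y h he with h | h | h | h <;> simp [h] at hxy <;> simp [π, h] <;>
          norm_num
      · rcases hxy with h | ⟨h, -⟩ | h | h | ⟨h, -⟩
        · simp [π, l, h]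
        · exact (he (Or.inl h)).elim
        · simp [π, l, h]; norm_num
        · simp [π, l, h]
        · exact (he (Or.inr h)).elim
    rintro r (rfl | rfl) x e y hs
    · have := hr₁ x e y hs
      exact key x e y (Route.isLink hs) (by tauto)
    · have := hr₂ x e y hs
      exact key x e y (Route.isLink hs) (by tauto))
  have hr₀' : ∀ r, r = r₀ ∨ r = r₀ → r = r₀ := by simp
  -- Splitting between `r₀` and itself sends the whole demand along `r₀`.
  obtain ⟨hgeq, hgcost⟩ := isICWE_splitFlow (T := T') (r₁ := r₀) (r₂ := r₀) rfl
    r₀.1.edges_mem r₀.1.edges_mem l (by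
    intro x e y h _
    change l y ≤ l x + cost e _
    rcases hWg e x y h with ⟨he, hc⟩ | ⟨he, hc⟩ <;> rw [hc]
    · rcases hlayαβ e x y h he with h | h | h | h <;> simp [l, h] <;> norm_num
    · linarith [neg_abs_le (l x - l y)]) (by
    intro r hr x e y hs
    obtain rfl := hr₀' r hr
    have h := Route.isLink hs
    have hxy := hr₀ x e y hs
    change l y = l x + cost e _
    rcases hWg e x y h with ⟨he, hc⟩ | ⟨he, hc⟩ <;> rw [hc]
    · rcases hlayαβ e x y h he with h | h | h | h <;> simp [h] at hxy <;> simp [l, h] <;>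
        norm_num
    · rcases hxy with h | ⟨h, -⟩ | h | ⟨h, -⟩
      · simp [l, h]
      · exact (he (Or.inl h)).elim
      · simp [l, h]
      · exact (he (Or.inr h)).elim)
  have hpos : ∀ r r' : N.Route, 0 < splitFlow r r' 0 r := by
    intro r r'
    simp only [splitFlow, if_true]
    positivity
  refine ⟨T, fun i => ?_, T', rfl, rfl, ⟨fun e he => he.1, fun h => ?_⟩, rfl,
    fun i hi => (hi (Subsingleton.elim i 0)).elim, _, _,
    ⟨_, hfeq, r₁, hA₁, hpos _ _, rfl⟩, ⟨_, hgeq, r₀, r₀.1.edges_mem, hpos _ _, rfl⟩, ?_⟩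
  · exact one_pos
  · obtain ⟨x, y, hxy, hx⟩ := hγ
    exact (h hxy.edge_mem : γ ∈ A).2 ⟨x, y, hxy, hx⟩
  · rw [← NNReal.coe_lt_coe, hfcost, hgcost]
    simp [π, l, hO, hD]
    norm_num

end TrafficNetwork

/-! ### Ears: walks as sequences, and pieces of walks between two sets -/

namespace Walk

variable {V E : Type*} {G : Graph V E}

/-- Positions on a route become natural numbers, so their order can be left to `omega`. The values
of `s` from `n` on are junk. -/
theorem exists_seq [Nonempty E] {u v : V} (w : Walk G u v) :
    ∃ (n : ℕ) (x : ℕ → V) (s : ℕ → E), x 0 = u ∧ x n = v ∧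
      w.support = (List.range (n + 1)).map x ∧
      (∀ k < n, G.IsLink (s k) (x k) (x (k + 1))) ∧
      ∀ a e b, (a, e, b) ∈ w.steps → ∃ k < n, a = x k ∧ b = x (k + 1) := by
  induction w with
  | @nil u => exact ⟨0, fun _ => u, fun _ => Classical.arbitrary E, rfl, rfl, rfl, by simp, by simp [steps]⟩
  | @cons u z v e h w ih =>
    obtain ⟨n, x, s, h0, hn, hsupp, hlink, hsteps⟩ := ih
    refine ⟨n + 1, fun k => k.casesOn u x, fun k => k.casesOn e s, rfl, hn, ?_, ?_, ?_⟩
    · rw [List.range_succ_eq_map, List.map_cons, List.map_map, support, hsupp]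
      rfl
    · rintro (_ | k) hk
      · simpa [h0] using h
      · exact hlink k (by omega)
    · intro a e' b hs
      simp only [steps, List.mem_cons, Prod.mk.injEq] at hs
      rcases hs with ⟨rfl, rfl, rfl⟩ | hs
      · exact ⟨0, by omega, rfl, h0.symm⟩
      · obtain ⟨k, hk, rfl, rfl⟩ := hsteps a e' b hs
        exact ⟨k + 1, by omega, rfl, rfl⟩

end Walk

/-- `u` and `v` are connected within the set `S` of vertices. -/
def ConnectedIn {V E : Type*} (G : Graph V E) (S : Set V) : V → V → Prop :=
  Reaches fun x e y => G.IsLink e x y ∧ x ∈ S ∧ y ∈ S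

theorem ConnectedIn.symm {V E : Type*} {G : Graph V E} {S : Set V} {u v : V}
    (h : ConnectedIn G S u v) : ConnectedIn G S v u :=
  h.swap.mono fun _ _ _ h => ⟨h.1.symm, h.2.2, h.2.1⟩

theorem ConnectedIn.mono {V E : Type*} {G : Graph V E} {S S' : Set V} {u v : V}
    (h : ConnectedIn G S u v) (hS : S ⊆ S') : ConnectedIn G S' u v :=
  Reaches.mono h fun _ _ _ h => ⟨h.1, hS h.2.1, hS h.2.2⟩

/-- A walk from `P` to `Q` contains a piece from `P` to `Q` all of whose inner vertices are
outside of both. -/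
theorem Walk.exists_connectedIn {V E : Type*} {G : Graph V E} {u v : V} (w : Walk G u v)
    (P Q : V → Prop) (hu : P u) (hv : Q v) :
    ∃ p q S, P p ∧ Q q ∧ p ∈ S ∧ q ∈ S ∧ S ⊆ {z | z ∈ w.support} ∧ ConnectedIn G S p q ∧
      ∀ z ∈ S, z = p ∨ z = q ∨ ¬ P z ∧ ¬ Q z := by
  -- Strengthened for induction: without `P u`, there is either a complete piece or an initial piece
  -- starting at `u`, which becomes complete once its start satisfies `P`.
  suffices h : (∃ p q S, P p ∧ Q q ∧ p ∈ S ∧ q ∈ S ∧ S ⊆ {z | z ∈ w.support} ∧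
      ConnectedIn G S p q ∧ ∀ z ∈ S, z = p ∨ z = q ∨ ¬ P z ∧ ¬ Q z) ∨
      ∃ q S, Q q ∧ u ∈ S ∧ q ∈ S ∧ S ⊆ {z | z ∈ w.support} ∧ ConnectedIn G S u q ∧
        ∀ z ∈ S, z = u ∨ z = q ∨ ¬ P z ∧ ¬ Q z from
    h.elim id fun ⟨q, S, h⟩ => ⟨u, q, S, hu, h⟩
  clear hu
  induction w with
  | @nil u => exact Or.inr ⟨u, {u}, hv, rfl, rfl, by simp [support], Relation.ReflTransGen.refl,
      by simp⟩
  | @cons u z v e h w ih =>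
    have hsub : {a | a ∈ w.support} ⊆ {a | a ∈ (cons e h w).support} := by
      intro a ha
      simpa [support] using Or.inr ha
    have hu : u ∈ (cons e h w).support := start_mem_support _
    rcases ih hv with ⟨p, q, S, hp, hq, hpS, hqS, hS, hconn, hoff⟩ |
      ⟨q, S, hq, hzS, hqS, hS, hconn, hoff⟩
    · exact Or.inl ⟨p, q, S, hp, hq, hpS, hqS, hS.trans hsub, hconn, hoff⟩
    · by_cases hPz : P z
      · exact Or.inl ⟨z, q, S, hPz, hq, hzS, hqS, hS.trans hsub, hconn, hoff⟩
      right
      by_cases hQz : Q z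
      · refine ⟨z, {u, z}, hQz, by simp, by simp, ?_,
          Relation.ReflTransGen.single ⟨e, h, by simp, by simp⟩, ?_⟩
        · rintro a (rfl | rfl)
          · exact hu
          · exact hsub w.start_mem_support
        · rintro a (rfl | rfl) <;> simp
      · refine ⟨q, insert u S, hq, by simp, by simp [hqS],
          Set.insert_subset hu (hS.trans hsub), ?_, ?_⟩
        · exact Relation.ReflTransGen.head ⟨e, h, by simp, by simp [hzS]⟩
            (hconn.mono (Set.subset_insert _ _))
        · rintro a (rfl | ha)
          · exact Or.inl rfl
          · rcases hoff a ha with rfl | rfl | h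
            · exact Or.inr (Or.inr ⟨hPz, hQz⟩)
            · exact Or.inr (Or.inl rfl)
            · exact Or.inr (Or.inr h)

theorem reaches_of_forall_succ {V E : Type*} {Q : V → E → V → Prop} {x : ℕ → V} {s : ℕ → E}
    {i j : ℕ} (hij : i ≤ j) (h : ∀ k, i ≤ k → k < j → Q (x k) (s k) (x (k + 1))) :
    Reaches Q (x i) (x j) := by
  induction j, hij using Nat.le_induction with
  | base => exact Relation.ReflTransGen.refl
  | succ j hij ih =>
    exact (ih fun k h₁ h₂ => h k h₁ (by omega)).tail ⟨s j, h j hij (by omega)⟩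

/-! ### Crossing ears in a network that is not series-parallel -/

namespace Network

variable {V E : Type*} {N : Network V E}

/-- The paradox occurs on a network in which a route has two crossing ears. -/
theorem exists_restrictedIBP_of_crossing {n : ℕ} {x : ℕ → V} {s : ℕ → E}
    (hO : x 0 = N.origin) (hD : x n = N.dest)
    (hlink : ∀ k < n, N.graph.IsLink (s k) (x k) (x (k + 1)))
    (hinj : ∀ i ≤ n, ∀ j ≤ n, x i = x j → i = j)
    {S₁ S₂ : Set V} (hdisj : ∀ z ∈ S₁, z ∉ S₂) {p₁ p₂ q₁ q₂ : ℕ}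
    (hp : p₁ < p₂) (hpq : p₂ < q₁) (hq : q₁ < q₂) (hqn : q₂ ≤ n)
    (h₁ : ConnectedIn N.graph S₁ (x p₁) (x q₁))
    (h₂ : ConnectedIn N.graph S₂ (x p₂) (x q₂))
    (hS₁ : ∀ k ≤ n, x k ∈ S₁ → k = p₁ ∨ k = q₁)
    (hS₂ : ∀ k ≤ n, x k ∈ S₂ → k = p₂ ∨ k = q₂) :
    ∃ T : TrafficNetwork N 1, (∀ i, 0 < T.demand i) ∧ T.RestrictedIBP := by
  classical
  -- Layer `2` is the single vertex `x q₁`, and layer `1` is the stretch of the route from `x p₂` up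
  -- to just before it. The second ear without its start joins layer `3`. The first ear without its
  -- end, like every vertex off the route and the ears, falls to the default layer `0`.
  let lay : V → Fin 4 := fun z =>
    if (∃ k, q₁ < k ∧ k ≤ n ∧ z = x k) ∨ (z ∈ S₂ ∧ z ≠ x p₂) then 3
    else if z = x q₁ then 2
    else if ∃ k, p₂ ≤ k ∧ k < q₁ ∧ z = x k then 1 else 0
  have lay₀ : ∀ k < p₂, lay (x k) = 0 := by
    intro k hk
    simp only [lay]
    rw [if_neg, if_neg, if_neg]
    · rintro ⟨j, h₁, h₂, h⟩
      have := hinj k (by omega) j (by omega) h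
      omega
    · intro h
      have := hinj k (by omega) _ (by omega) h
      omega
    · rintro (⟨j, h₁, h₂, h⟩ | ⟨h, -⟩)
      · have := hinj k (by omega) j (by omega) h
        omega
      · have := hS₂ k (by omega) h
        omega
  have lay₁ : ∀ k, p₂ ≤ k → k < q₁ → lay (x k) = 1 := by
    intro k hk hk'
    simp only [lay]
    rw [if_neg, if_neg, if_pos ⟨k, hk, hk', rfl⟩]
    · intro h
      have := hinj k (by omega) _ (by omega) h
      omega
    · rintro (⟨j, h₁, h₂, h⟩ | ⟨h, h'⟩)
      · have := hinj k (by omega) j (by omega) h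
        omega
      · rcases hS₂ k (by omega) h with rfl | rfl
        · exact h' rfl
        · omega
  have lay₂ : lay (x q₁) = 2 := by
    simp only [lay]
    rw [if_neg, if_true]
    rintro (⟨j, h₁, h₂, h⟩ | ⟨h, -⟩)
    · have := hinj q₁ (by omega) j (by omega) h
      omega
    · have := hS₂ q₁ (by omega) h
      omega
  have lay₃ : ∀ k, q₁ < k → k ≤ n → lay (x k) = 3 := fun k hk hk' =>
    if_pos (Or.inl ⟨k, hk, hk', rfl⟩)
  have layS₁ : ∀ z ∈ S₁, z ≠ x q₁ → lay z = 0 := by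
    intro z hz hne
    simp only [lay]
    rw [if_neg, if_neg hne, if_neg]
    · rintro ⟨j, h₁, h₂, rfl⟩
      have := hS₁ j (by omega) hz
      omega
    · rintro (⟨j, h₁, h₂, rfl⟩ | ⟨h, -⟩)
      · have := hS₁ j (by omega) hz
        omega
      · exact hdisj z hz h
  have layS₂ : ∀ z ∈ S₂, z ≠ x p₂ → lay z = 3 := fun z hz hne => if_pos (Or.inr ⟨hz, hne⟩)
  have lay_step : ∀ k < n, (lay (x k) = lay (x (k + 1))) ∨
      (k + 1 = p₂ ∧ lay (x k) = 0 ∧ lay (x (k + 1)) = 1) ∨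
      (k + 1 = q₁ ∧ lay (x k) = 1 ∧ lay (x (k + 1)) = 2) ∨
      (k = q₁ ∧ lay (x k) = 2 ∧ lay (x (k + 1)) = 3) := by
    intro k hk
    rcases lt_trichotomy (k + 1) p₂ with h | h | h
    · exact Or.inl ((lay₀ k (by omega)).trans (lay₀ _ h).symm)
    · exact Or.inr (Or.inl ⟨h, lay₀ k (by omega), lay₁ _ (by omega) (by omega)⟩)
    rcases lt_trichotomy (k + 1) q₁ with h' | h' | h'
    · exact Or.inl ((lay₁ k (by omega) (by omega)).trans (lay₁ _ (by omega) h').symm)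
    · exact Or.inr (Or.inr (Or.inl ⟨h', lay₁ k (by omega) (by omega), h' ▸ lay₂⟩))
    rcases eq_or_ne k q₁ with h'' | h''
    · exact Or.inr (Or.inr (Or.inr ⟨h'', h'' ▸ lay₂, lay₃ _ (by omega) (by omega)⟩))
    · exact Or.inl ((lay₃ k (by omega) (by omega)).trans (lay₃ _ (by omega) (by omega)).symm)
  have hlinkα := hlink (p₂ - 1) (by omega)
  rw [show p₂ - 1 + 1 = p₂ by omega] at hlinkα
  have hlinkγ := hlink (q₁ - 1) (by omega)
  rw [show q₁ - 1 + 1 = q₁ by omega] at hlinkγ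
  -- `α` enters `x p₂`, `β` leaves `x q₁`, and `γ` enters `x q₁` along the route.
  refine TrafficNetwork.exists_restrictedIBP_of_layers lay (α := s (p₂ - 1)) (β := s q₁)
    (γ := s (q₁ - 1)) (hO ▸ lay₀ 0 (by omega)) (hD ▸ lay₃ n (by omega) le_rfl)
    ⟨_, _, hlinkα, lay₀ _ (by omega), lay₁ _ le_rfl hpq⟩
    ⟨_, _, hlink q₁ (by omega), lay₂, lay₃ _ (by omega) (by omega)⟩
    ⟨_, _, hlinkγ, lay₁ _ (by omega) (by omega), lay₂⟩ ?_ ?_ ?_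
  · rw [← hO, ← hD]
    refine reaches_of_forall_succ (s := s) (Nat.zero_le n) fun k _ hk => ⟨hlink k hk, ?_⟩
    rcases lay_step k hk with h | ⟨h, h'⟩ | ⟨h, h'⟩ | ⟨rfl, h'⟩
    · exact Or.inl h
    · exact Or.inr (Or.inl ⟨by rw [← h, Nat.add_sub_cancel], h'⟩)
    · exact Or.inr (Or.inr (Or.inl h'))
    · exact Or.inr (Or.inr (Or.inr ⟨rfl, h'⟩))
  · rw [← hO, ← hD]
    refine Relation.ReflTransGen.trans (b := x p₂) (reaches_of_forall_succ (s := s)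
      (Nat.zero_le p₂) fun k _ hk => ⟨hlink k (by omega), ?_⟩)
      (Relation.ReflTransGen.trans (b := x q₂) ?_
      (reaches_of_forall_succ (s := s) hqn fun k hk hk' => ⟨hlink k hk', Or.inl
        ((lay₃ k (by omega) (by omega)).trans (lay₃ _ (by omega) (by omega)).symm)⟩))
    · rcases lay_step k (by omega) with h | ⟨h, h'⟩ | ⟨h, h'⟩ | ⟨rfl, h'⟩
      · exact Or.inl h
      · exact Or.inr (Or.inl ⟨by rw [← h, Nat.add_sub_cancel], h'⟩)
      · omega
      · omega
    · generalize x q₂ = y at h₂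
      induction h₂ with
      | refl => exact Relation.ReflTransGen.refl
      | @tail b c _ h ih =>
        obtain ⟨e, he, hb, hc⟩ := h
        -- The connection may return to its start, and a step from layer `3` to layer `1` is not
        -- allowed; in that case begin again at `x p₂`.
        by_cases hcp : c = x p₂
        · rw [hcp]
        refine Relation.ReflTransGen.tail ih ⟨e, he, ?_⟩
        rw [layS₂ c hc hcp]
        by_cases hbp : b = x p₂
        · rw [hbp, lay₁ _ le_rfl hpq]; simp
        · exact Or.inl (layS₂ b hb hbp)
  · rw [← hO, ← hD]
    refine Relation.ReflTransGen.trans (b := x p₁) (reaches_of_forall_succ (s := s)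
      (Nat.zero_le p₁) fun k _ hk => ⟨hlink k (by omega), Or.inl
        ((lay₀ k (by omega)).trans (lay₀ _ (by omega)).symm)⟩)
      (Relation.ReflTransGen.trans (b := x q₁) ?_
      (reaches_of_forall_succ (s := s) (hq.le.trans hqn) fun k hk hk' => ⟨hlink k hk', ?_⟩))
    -- The connection may leave `x q₁` again, and a step from layer `2` to layer `0` is not allowed;
    -- so stop at the first arrival.
    · have key : ∀ y, ConnectedIn N.graph S₁ (x p₁) y →
          Reaches (fun x e y => N.graph.IsLink e x y ∧ (lay x = lay y ∨
            (lay x = 0 ∧ lay y = 2) ∨ (e = s q₁ ∧ lay x = 2 ∧ lay y = 3))) (x p₁) y ∨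
          Reaches (fun x e y => N.graph.IsLink e x y ∧ (lay x = lay y ∨
            (lay x = 0 ∧ lay y = 2) ∨ (e = s q₁ ∧ lay x = 2 ∧ lay y = 3))) (x p₁) (x q₁) := by
        intro y hy
        induction hy with
        | refl => exact Or.inl Relation.ReflTransGen.refl
        | @tail b c _ h ih =>
          obtain ⟨e, he, hb, hc⟩ := h
          rcases ih with ih | ih
          · by_cases hbq : b = x q₁
            · exact Or.inr (hbq ▸ ih)
            · refine Or.inl (Relation.ReflTransGen.tail ih ⟨e, he, ?_⟩)
              rw [layS₁ b hb hbq]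
              by_cases hcq : c = x q₁
              · rw [hcq, lay₂]; simp
              · exact Or.inl (layS₁ c hc hcq).symm
          · exact Or.inr ih
      exact (key _ h₁).elim id id
    · rcases lay_step k hk' with h | ⟨h, h'⟩ | ⟨h, h'⟩ | ⟨rfl, h'⟩
      · exact Or.inl h
      · omega
      · omega
      · exact Or.inr (Or.inr ⟨rfl, h'⟩)

/-- Let the second route pass the edge backwards. Its part `w₁` before the edge and its part `w₂`
after it are disjoint. An ear of the first route taken from `w₁` jumps over the edge, and one taken
from `w₂` leaves the segment under that ear, so the two cross. -/
theorem exists_restrictedIBP (hN : ¬ N.IsSeriesParallel) :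
    ∃ T : TrafficNetwork N 1, (∀ i, 0 < T.demand i) ∧ T.RestrictedIBP := by
  simp only [IsSeriesParallel, not_forall, not_not] at hN
  obtain ⟨r, r', e, u, v, hr, hr'⟩ := hN
  have : Nonempty E := ⟨e⟩
  obtain ⟨n, x, s, hO, hD, hsupp, hlink, hsteps⟩ := r.1.exists_seq
  have hinj : ∀ i ≤ n, ∀ j ≤ n, x i = x j → i = j := by
    intro i hi j hj h
    have hnd : ((List.range (n + 1)).map x).Nodup := hsupp ▸ r.2
    exact List.inj_on_of_nodup_map hnd (List.mem_range.2 (by omega))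
      (List.mem_range.2 (by omega)) h
  obtain ⟨i, hi, rfl, rfl⟩ := hsteps _ _ _ hr
  obtain ⟨w₁, w₂, hw, -⟩ := r'.1.exists_split hr'
  have hdisj : ∀ z ∈ w₁.support, z ∉ w₂.support := by
    have : (w₁.support ++ w₂.support).Nodup := hw ▸ r'.2
    exact fun z h₁ h₂ => List.disjoint_of_nodup_append this h₁ h₂
  obtain ⟨_, _, S₁, ⟨p, hpi, rfl⟩, ⟨q, hiq, hqn, rfl⟩, hpS₁, hqS₁, hS₁, hconn₁, hoff₁⟩ :=
    w₁.exists_connectedIn (fun z => ∃ k, k ≤ i ∧ z = x k) (fun z => ∃ k, i < k ∧ k ≤ n ∧ z = x k)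
      ⟨0, Nat.zero_le i, hO.symm⟩ ⟨i + 1, by omega, by omega, rfl⟩
  have hear₁ : ∀ k ≤ n, x k ∈ S₁ → k = p ∨ k = q := by
    intro k hk h
    rcases hoff₁ _ h with h | h | ⟨h, h'⟩
    · exact Or.inl (hinj _ hk _ (by omega) h)
    · exact Or.inr (hinj _ hk _ hqn h)
    · rcases le_or_gt k i with h'' | h''
      · exact (h ⟨k, h'', rfl⟩).elim
      · exact (h' ⟨k, h'', hk, rfl⟩).elim
  -- The vertices `x i` and `x n` lie on `w₂`, so an ear inside `w₁` cannot end at either. Hence `x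
  -- i` lies strictly under the ear and the destination strictly beyond it.
  have hpi' : p < i := by
    refine lt_of_le_of_ne hpi ?_
    rintro rfl
    exact hdisj _ (hS₁ hpS₁) w₂.start_mem_support
  have hqn' : q < n := by
    refine lt_of_le_of_ne hqn ?_
    rintro rfl
    exact hdisj _ (hS₁ hqS₁) (by rw [hD]; exact w₂.end_mem_support)
  obtain ⟨_, _, S₂, ⟨a, hpa, haq, rfl⟩, ⟨b, hb, hbn, rfl⟩, haS₂, hbS₂, hS₂, hconn₂, hoff₂⟩ :=
    w₂.exists_connectedIn (fun z => ∃ k, p < k ∧ k < q ∧ z = x k)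
      (fun z => ∃ k, (k < p ∨ q < k) ∧ k ≤ n ∧ z = x k)
      ⟨i, hpi', hiq, rfl⟩ ⟨n, Or.inr hqn', le_rfl, hD.symm⟩
  have hdisj' : ∀ z ∈ S₁, z ∉ S₂ := fun z h₁ h₂ => hdisj z (hS₁ h₁) (hS₂ h₂)
  have hear₂ : ∀ k ≤ n, x k ∈ S₂ → k = a ∨ k = b := by
    intro k hk h
    have hkp : k ≠ p := by rintro rfl; exact hdisj' _ hpS₁ h
    have hkq : k ≠ q := by rintro rfl; exact hdisj' _ hqS₁ h
    rcases hoff₂ _ h with h | h | ⟨h, h'⟩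
    · exact Or.inl (hinj _ hk _ (by omega) h)
    · exact Or.inr (hinj _ hk _ hbn h)
    · by_cases h'' : p < k ∧ k < q
      · exact (h ⟨k, h''.1, h''.2, rfl⟩).elim
      · exact (h' ⟨k, by omega, hk, rfl⟩).elim
  -- The second ear may land before or after the first one. If before, it is reversed and plays the
  -- role of the first ear.
  rcases hb with hb | hb
  · exact exists_restrictedIBP_of_crossing hO hD hlink hinj (fun z h₂ h₁ => hdisj' z h₁ h₂)
      hb hpa haq hqn hconn₂.symm hconn₁ (fun k hk h => (hear₂ k hk h).symm) hear₁
  · exact exists_restrictedIBP_of_crossing hO hD hlink hinj hdisj' hpa haq hb hbn hconn₁ hconn₂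
      hear₁ hear₂

end Network

end InfoBraess

theorem theorem4 {V E : Type*} (N : InfoBraess.Network V E) :
    ((∀ (K : ℕ) [NeZero K] (T : InfoBraess.TrafficNetwork N K), ¬ T.RestrictedIBP) ↔
      N.IsSeriesParallel) ∧
    (N.IsSeriesParallel →
      ∀ (K : ℕ) [NeZero K] (T : InfoBraess.TrafficNetwork N K), ¬ T.RestrictedIBP) ∧
    (¬ N.IsSeriesParallel →
      ∃ (K : ℕ) (_ : NeZero K) (T : InfoBraess.TrafficNetwork N K),
        (∀ i, 0 < T.demand i) ∧ T.RestrictedIBP) := by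
  refine ⟨⟨fun h => ?_, fun hN K _ T => T.not_restrictedIBP hN⟩,
    fun hN K _ T => T.not_restrictedIBP hN, fun hN => ?_⟩
  · by_contra hN
    obtain ⟨T, -, hT⟩ := InfoBraess.Network.exists_restrictedIBP hN
    exact h 1 T hT
  · obtain ⟨T, hT⟩ := InfoBraess.Network.exists_restrictedIBP hN
    exact ⟨1, inferInstance, T, hT⟩
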